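/- Let $R$ be a commutative artinian ring and let $\Lambda$ be an artin $R$-algebra (an $R$-algebra that is finitely generated as an $R$-module) that is Nakayama: the submodules of every indecomposable projective right $\Lambda$-module, and of every indecomposable projective left $\Lambda$-module, are totally ordered by inclusion. Let $\operatorname{mod}\Lambda$ be the category of finitely generated right $\Lambda$-modules, and for $M\in\operatorname{mod}\Lambda$ let $\operatorname{top}M=M/\operatorname{rad}M$, where $\operatorname{rad} M$ is the intersection of the maximal submodules of $M$. Let $\mathcal F$ be a torsion-free class of $\operatorname{mod}\Lambda$, i.e. there is a pair $(\mathcal T,\mathcal F)$ of full isomorphism-closed subcategories with $\operatorname{Hom}_\Lambda(\mathcal T,\mathcal F)=0$ such that every $X\in\operatorname{mod}\Lambda$ admits a short exact sequence $0\to T\to X\to F\to 0$ with $T\in\mathcal T$ and $F\in\mathcal F$. Regard $\mathcal F$ as an exact category whose conflations are the short exact sequences of $\operatorname{mod}\Lambda$ with all terms in $\mathcal F$. Thus an object $X\in\mathcal F$ is simple in $\mathcal F$ if $X\ne0$ and there is no short exact sequence $0\to L\to X\to N\to0$ with $L,N\in\mathcal F$ both nonzero; and $P\in\mathcal F$ is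 projective in $\mathcal F$ if every morphism $P\to Z$ lifts along $Y\to Z$ for every short exact sequence $0\to X\to Y\to Z\to0$ with $X,Y,Z\in\mathcal F$. For every indecomposable object $M$ of $\mathcal F$, the module $\operatorname{top}M$ is simple. Consider the sets 1. $\operatorname{top}\mathcal F$, the set of isomorphism classes of the simple modules $\operatorname{top}M$ for $M$ indecomposable in $\mathcal F$; 2. $\operatorname{simp}\mathcal F$, the set of isomorphism classes of simple objects of $\mathcal F$; 3. $\operatorname{ind}\mathcal P(\mathcal F)$, the set of isomorphism classes of indecomposable projective objects of $\mathcal F$. Then $M\mapsto\operatorname{top}M$ induces bijections $\operatorname{simp}\mathcal F\to\operatorname{top}\mathcal F$ and $\operatorname{ind}\mathcal P(\mathcal F)\to\operatorname{top}\mathcal F$. Moreover, for a simple module $S$ write $S^{(i)}$ for the indecomposable module in $\operatorname{mod}\Lambda$ with top isomorphic to $S$ and length $i$ (unique up to isomorphism if it exists). For every $S\in\operatorname{top}\mathcal F$, the minimum $m=\min\{i\mid S^{(i)}\in\mathcal F\}$ and the maximum $n=\max\{i\mid S^{(i)}\in\mathcal F\}$ exist; up to isomorphism, $S^{(m)}$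 is the simple object of $\mathcal F$ with top $S$, and $S^{(n)}$ is the indecomposable projective object of $\mathcal F$ with top $S$. -/

import Mathlib

open CategoryTheory CategoryTheory.Limits

universe u w

namespace NakayamaTorsionFree

section ExactCategories

variable {C : Type*} [Category* C] [Preadditive C]

/-! `C` is the ambient category (below: the abelian category of finitely generated modules);
its full subcategories are given by properties of objects. -/

/-- A conflation of the full subcategory `E` of `C`: a short exact sequence of `C` all of whose
terms belong to `E`. -/
def IsConflation (E : ObjectProperty C) (s : ShortComplex C) : Prop :=
  s.ShortExact ∧ E s.X₁ ∧ E s.X₂ ∧ E s.X₃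

/-- A torsion pair `(T, F)` in `C`: two full, isomorphism-closed subcategories such that
`Hom(T, F) = 0` and every object `X` is the middle term of a short exact sequence
`0 → T' → X → F' → 0` with `T'` in `T` and `F'` in `F`. -/
structure IsTorsionPair (T F : ObjectProperty C) : Prop where
  closed_left : T.IsClosedUnderIsomorphisms
  closed_right : F.IsClosedUnderIsomorphisms
  hom_eq_zero : ∀ ⦃X Y : C⦄, T X → F Y → ∀ f : X ⟶ Y, f = 0
  exists_shortExact : ∀ X : C, ∃ (T' F' : C) (i : T' ⟶ X) (p : X ⟶ F') (h : i ≫ p = 0),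
    T T' ∧ F F' ∧ (ShortComplex.mk i p h).ShortExact

/-- `F` is a torsion-free class: it is the second half of a torsion pair. -/
def IsTorsionFreeClass (F : ObjectProperty C) : Prop :=
  ∃ T : ObjectProperty C, IsTorsionPair T F

/-- `X` is a simple object of the exact category `E`: it is a nonzero object of `E`, and there is
no conflation `L ↣ X ↠ N` of `E` with `L` and `N` both nonzero. -/
def IsSimpleObject (E : ObjectProperty C) (X : C) : Prop :=
  E X ∧ ¬ IsZero X ∧
    ∀ (L N : C) (i : L ⟶ X) (p : X ⟶ N) (h : i ≫ p = 0),
      IsConflation E (ShortComplex.mk i p h) → IsZero L ∨ IsZero N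

/-- `P` is a projective object of the exact category `E`: it belongs to `E` and every morphism
from `P` to `Z` lifts along every deflation `Y ↠ Z` of `E`. -/
def IsProjectiveObject (E : ObjectProperty C) (P : C) : Prop :=
  E P ∧ ∀ (X Y Z : C) (i : X ⟶ Y) (p : Y ⟶ Z) (h : i ≫ p = 0),
    IsConflation E (ShortComplex.mk i p h) → ∀ f : P ⟶ Z, ∃ g : P ⟶ Y, g ≫ p = f

/-- `X` is an indecomposable object of the full subcategory `E`: it is a nonzero object of `E`
and whenever it is a direct sum of two objects of `E`, one of these is zero. -/
def IsIndecomposable (E : ObjectProperty C) (X : C) : Prop :=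
  E X ∧ ¬ IsZero X ∧
    ∀ (Y Z : C), E Y → E Z → ∀ b : BinaryBicone Y Z, Nonempty b.IsBilimit →
      Nonempty (X ≅ b.pt) → IsZero Y ∨ IsZero Z

end ExactCategories

section Modules

/-- A module is uniserial if its submodules are totally ordered by inclusion. -/
def IsUniserial (A : Type*) [Ring A] (M : Type*) [AddCommGroup M] [Module A M] : Prop :=
  ∀ N K : Submodule A M, N ≤ K ∨ K ≤ N

/-- Every indecomposable finitely generated projective `A`-module is uniserial. -/
def ProjectivesUniserial (A : Type u) [Ring A] : Prop :=
  ∀ P : FGModuleCat.{u} A, IsIndecomposable ⊤ P → Module.Projective A P → IsUniserial A P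

/-- An (artin) algebra `Λ` is Nakayama if all its indecomposable projective modules, right
(i.e. over `Λᵐᵒᵖ`) and left, are uniserial. -/
def IsNakayama (Λ : Type u) [Ring Λ] : Prop :=
  ProjectivesUniserial Λᵐᵒᵖ ∧ ProjectivesUniserial Λ

variable {A : Type u} [Ring A]

/-- The top `M / rad M` of a finitely generated module, where `rad M` is the intersection of the
maximal submodules of `M`. -/
noncomputable def top (M : FGModuleCat.{u} A) : FGModuleCat.{u} A :=
  FGModuleCat.of A (M ⧸ Module.jacobson A M)

theorem nonempty_top_iso {M N : FGModuleCat.{u} A} (e : M ≅ N) : Nonempty (top M ≅ top N) := by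
  let l : M ≃ₗ[A] N := FGModuleCat.isoToLinearEquiv e
  have h : (Module.jacobson A M).map (l : M →ₗ[A] N) = Module.jacobson A N :=
    Module.map_jacobson_of_bijective l.bijective
  exact ⟨(Submodule.Quotient.equiv _ _ l h).toFGModuleCatIso⟩

/-- Isomorphism classes of finitely generated `A`-modules. -/
abbrev IsoClass (A : Type u) [Ring A] : Type (u + 1) :=
  Quotient (isIsomorphicSetoid (FGModuleCat.{u} A))

/-- The isomorphism class of `M`. -/
def isoClass (M : FGModuleCat.{u} A) : IsoClass A :=
  Quotient.mk (isIsomorphicSetoid (FGModuleCat.{u} A)) M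

/-- The map `[M] ↦ [top M]` on isomorphism classes. -/
noncomputable def topClass : IsoClass A → IsoClass A :=
  Quotient.map (sa := isIsomorphicSetoid _) (sb := isIsomorphicSetoid _) top
    fun _ _ h => h.elim nonempty_top_iso

/-- The isomorphism classes of the modules `top M`, for `M` an indecomposable object of `F`. -/
def topSet (F : ObjectProperty (FGModuleCat.{u} A)) : Set (IsoClass A) :=
  {c | ∃ M, IsIndecomposable F M ∧ c = isoClass (top M)}

/-- The isomorphism classes of simple objects of `F`. -/
def simpSet (F : ObjectProperty (FGModuleCat.{u} A)) : Set (IsoClass A) :=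
  {c | ∃ M, IsSimpleObject F M ∧ c = isoClass M}

/-- The isomorphism classes of indecomposable projective objects of `F`. -/
def indProjSet (F : ObjectProperty (FGModuleCat.{u} A)) : Set (IsoClass A) :=
  {c | ∃ M, (IsIndecomposable F M ∧ IsProjectiveObject F M) ∧ c = isoClass M}

/-- `M` is a module `S^(i)`: an indecomposable finitely generated module with top isomorphic to
`S` and of length `i`. -/
def IsIndecWithTop (S : FGModuleCat.{u} A) (i : ℕ) (M : FGModuleCat.{u} A) : Prop :=
  IsIndecomposable ⊤ M ∧ Nonempty (top M ≅ S) ∧ Module.length A M = i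

/-- The set of all `i` such that `S^(i)` exists and belongs to `F`. -/
def lengthSet (F : ObjectProperty (FGModuleCat.{u} A)) (S : FGModuleCat.{u} A) : Set ℕ :=
  {i | ∃ M, IsIndecWithTop S i M ∧ F M}

end Modules

end NakayamaTorsionFree

/-! Right Λ-modules are treated as left modules over A = Λᵐᵒᵖ. The Nakayama hypothesis enters only
through idempotents e with Ae and eA both uniserial. Primitive idempotents have this property and
span A as a left ideal (`IsNakayama.span_isBiserialIdempotent`).

The classical core is that indecomposable finitely generated modules are uniserial. If x = ex
generates a submodule of maximal length among such cyclic submodules of M, then Ax is a direct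
summand: the identity of Ax extends to M one generator at a time (`exists_forall_smul_mem_eq`,
`exists_retraction`). So an indecomposable M equals Ax, a quotient of Ae.

Two uniserial modules with the same top are generated by elements fixed by one and the same e, and
their annihilators are comparable. Hence the longer module surjects onto the shorter, and top and
length determine an indecomposable module.

A torsion-free class F is closed under submodules, so every surjection between objects of F is a
deflation. Fix a top S. The shortest S^(m) in F has no proper nonzero quotient in F, and every other
S^(i) in F has S^(m) as one; thus S^(m) is the simple object. The longest S^(n) is projective, since
a lift of its generator cannot have a smaller annihilator without generating a longer module of F
with top S. Any other S^(i) in F is a proper quotient of S^(n), and projectivity would split that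
quotient map. Both bijections follow. -/

namespace NakayamaTorsionFree

/-! ### Cyclic and uniserial modules, and the splitting of a longest cyclic submodule -/

section Serial

/-- An idempotent `e` such that the submodules of `Ae` and of `eA` are totally ordered; this is
expressed by comparing principal submodules. -/
structure IsBiserialIdempotent {A : Type*} [Ring A] (e : A) : Prop where
  idem : e * e = e
  left : ∀ a b : A, ∃ c, a * e = c * (b * e) ∨ b * e = c * (a * e)
  right : ∀ a b : A, ∃ c, e * a = e * b * c ∨ e * b = e * a * c

variable {A : Type*} [Ring A] {M : Type*} [AddCommGroup M] [Module A M]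
  {N : Type*} [AddCommGroup N] [Module A N]

/-- The module `N` is a quotient of the cyclic module generated by `x`, via `x ↦ y`. -/
theorem exists_linearMap_of_annihilator_le {x : M} (hx : Submodule.span A {x} = ⊤) {y : N}
    (h : ∀ a : A, a • x = 0 → a • y = 0) : ∃ f : M →ₗ[A] N, f x = y := by
  have hs : Function.Surjective (LinearMap.toSpanSingleton A M x) := by
    rw [← LinearMap.range_eq_top, ← LinearMap.span_singleton_eq_range, hx]
  have hk : LinearMap.ker (LinearMap.toSpanSingleton A M x) ≤
      LinearMap.ker (LinearMap.toSpanSingleton A N y) := fun a ha => by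
    simpa using h a (by simpa using ha)
  refine ⟨(Submodule.liftQ _ _ hk).comp
    ((LinearMap.toSpanSingleton A M x).quotKerEquivOfSurjective hs).symm.toLinearMap, ?_⟩
  have : ((LinearMap.toSpanSingleton A M x).quotKerEquivOfSurjective hs).symm x =
      Submodule.Quotient.mk 1 := by
    rw [LinearEquiv.symm_apply_eq]
    simp
  simp [this]

theorem exists_linearMap_span_of_annihilator_le {x : M} {y : N}
    (h : ∀ a : A, a • x = 0 → a • y = 0) :
    ∃ f : Submodule.span A {x} →ₗ[A] N, ∀ a : A, ∀ h, f ⟨a • x, h⟩ = a • y := by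
  obtain ⟨f, hf⟩ := exists_linearMap_of_annihilator_le
    (x := (⟨x, Submodule.mem_span_singleton_self x⟩ : Submodule.span A {x})) (y := y)
    (by
      rw [eq_top_iff]
      rintro ⟨z, hz⟩ -
      obtain ⟨a, rfl⟩ := Submodule.mem_span_singleton.1 hz
      exact Submodule.mem_span_singleton.2 ⟨a, rfl⟩)
    (fun a ha => h a (by simpa using congrArg Subtype.val ha))
  refine ⟨f, fun a h => ?_⟩
  rw [← hf, ← map_smul]
  rfl

theorem isUniserial_of_forall_smul (h : ∀ x y : M, ∃ a : A, x = a • y ∨ y = a • x) :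
    IsUniserial A M := by
  intro N K
  by_contra! hc
  obtain ⟨x, hxN, hxK⟩ := SetLike.not_le_iff_exists.1 hc.1
  obtain ⟨y, hyK, hyN⟩ := SetLike.not_le_iff_exists.1 hc.2
  obtain ⟨a, rfl | rfl⟩ := h x y
  · exact hxK (K.smul_mem a hyK)
  · exact hyN (N.smul_mem a hxN)

theorem IsUniserial.exists_smul (h : IsUniserial A M) (x y : M) :
    ∃ a : A, x = a • y ∨ y = a • x := by
  rcases h (Submodule.span A {x}) (Submodule.span A {y}) with h | h <;>
    obtain ⟨a, ha⟩ := Submodule.mem_span_singleton.1 (h (Submodule.mem_span_singleton_self _))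
  · exact ⟨a, .inl ha.symm⟩
  · exact ⟨a, .inr ha.symm⟩

theorem IsUniserial.of_surjective (h : IsUniserial A M) (f : M →ₗ[A] N)
    (hf : Function.Surjective f) : IsUniserial A N := by
  refine isUniserial_of_forall_smul fun x y => ?_
  obtain ⟨x, rfl⟩ := hf x
  obtain ⟨y, rfl⟩ := hf y
  obtain ⟨a, rfl | rfl⟩ := h.exists_smul x y
  · exact ⟨a, .inl (by simp)⟩
  · exact ⟨a, .inr (by simp)⟩

theorem IsBiserialIdempotent.isUniserial_span {e : A} (he : IsBiserialIdempotent e) {x : M}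
    (hx : e • x = x) : IsUniserial A (Submodule.span A {x}) := by
  refine isUniserial_of_forall_smul ?_
  rintro ⟨y, hy⟩ ⟨z, hz⟩
  obtain ⟨a, rfl⟩ := Submodule.mem_span_singleton.1 hy
  obtain ⟨b, rfl⟩ := Submodule.mem_span_singleton.1 hz
  obtain ⟨c, hc⟩ := he.left a b
  refine ⟨c, hc.imp (fun hc => Subtype.ext ?_) (fun hc => Subtype.ext ?_)⟩ <;>
  · have := congrArg (· • x) hc
    simpa [mul_smul, hx] using this

/-- Elements x and y fixed by e are the images of e under maps out of Ae, whose kernels are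
comparable because Ae is uniserial. -/
theorem IsBiserialIdempotent.annihilator_le_or {e : A} (he : IsBiserialIdempotent e)
    {x : M} {y : N} (hx : e • x = x) (hy : e • y = y) :
    (∀ a : A, a • x = 0 → a • y = 0) ∨ (∀ a : A, a • y = 0 → a • x = 0) := by
  by_contra! hc
  obtain ⟨⟨a, hax, hay⟩, ⟨b, hby, hbx⟩⟩ := hc
  obtain ⟨c, hc | hc⟩ := he.left a b
  · have := congrArg (· • y) hc
    simp [mul_smul, hy, hby, hay] at this
  · have := congrArg (· • x) hc
    simp [mul_smul, hx, hbx, hax] at this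

/-- If eM ⊆ K for every biserial e, then aM ⊆ K for every a in their span, in particular for a = 1.
-/
theorem exists_smul_notMem (hA : Ideal.span {e : A | IsBiserialIdempotent e} = ⊤)
    {K : Submodule A M} (hK : K ≠ ⊤) :
    ∃ e : A, IsBiserialIdempotent e ∧ ∃ z, z ∉ K ∧ e • z = z := by
  by_contra! h
  apply hK
  have h1 : ∀ a ∈ Ideal.span {e : A | IsBiserialIdempotent e}, ∀ z : M, a • z ∈ K := by
    intro a ha
    induction ha using Submodule.span_induction with
    | mem e he =>
      intro z
      by_contra hz
      exact h e he _ hz (by rw [← mul_smul, he.idem])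
    | zero => simp
    | add a b _ _ ha hb => exact fun z => by rw [add_smul]; exact K.add_mem (ha z) (hb z)
    | smul a b _ hb => exact fun z => by rw [smul_eq_mul, mul_smul]; exact K.smul_mem _ (hb z)
  rw [eq_top_iff]
  intro z _
  simpa using h1 1 (by simp [hA]) z

theorem IsUniserial.span_singleton_eq_top (hM : IsUniserial A M) {K : Submodule A M}
    (hK : IsCoatom K) {x : M} (hx : x ∉ K) : Submodule.span A {x} = ⊤ := by
  rcases hM (Submodule.span A {x}) K with h | h
  · exact absurd (h (Submodule.mem_span_singleton_self x)) hx
  · refine hK.2 _ (lt_of_le_of_ne h ?_)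
    rintro rfl
    exact hx (Submodule.mem_span_singleton_self x)

theorem IsUniserial.exists_span_eq_top [Module.Finite A M] [Nontrivial M]
    (hA : Ideal.span {e : A | IsBiserialIdempotent e} = ⊤) (hM : IsUniserial A M) :
    ∃ e : A, IsBiserialIdempotent e ∧ ∃ x : M, e • x = x ∧ Submodule.span A {x} = ⊤ := by
  obtain ⟨K, hK, -⟩ := (eq_top_or_exists_le_coatom (⊥ : Submodule A M)).resolve_left bot_ne_top
  obtain ⟨e, he, z, hz, hez⟩ := exists_smul_notMem hA hK.1
  exact ⟨e, he, z, hez, hM.span_singleton_eq_top hK hz⟩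

/-- The extension step: a linear map from a submodule `K` to a cyclic module generated by an
element `x` with span of maximal length extends along one more generator `z`. -/
theorem exists_forall_smul_mem_eq [IsArtinianRing A] [IsNoetherianRing A] [Module.Finite A M]
    (hA : Ideal.span {e : A | IsBiserialIdempotent e} = ⊤)
    {e f : A} (he : IsBiserialIdempotent e) (hf : IsBiserialIdempotent f) {x z : M}
    (hx : e • x = x) (hz : f • z = z)
    (hmax : ∀ g : A, IsBiserialIdempotent g → ∀ y : M, g • y = y →
      Module.length A (Submodule.span A {y}) ≤ Module.length A (Submodule.span A {x}))
    {K : Submodule A M} (ρ : K →ₗ[A] M) (hρ : ∀ k, ρ k ∈ Submodule.span A {x}) :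
    ∃ u ∈ Submodule.span A {x}, ∀ a : A, ∀ h : a • z ∈ K, ρ ⟨a • z, h⟩ = a • u := by
  -- The elements of Af carrying z into K: exactly where a choice of image for z is constrained. As
  -- Af is uniserial, I is cyclic, so a single generator t carries the whole constraint.
  let I : Submodule A A :=
    { carrier := {a | a * f = a ∧ a • z ∈ K}
      add_mem' := fun {a b} ha hb =>
        ⟨by rw [add_mul, ha.1, hb.1], by rw [add_smul]; exact K.add_mem ha.2 hb.2⟩
      zero_mem' := by simp
      smul_mem' := fun c a ha =>
        ⟨by rw [smul_eq_mul, mul_assoc, ha.1],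
          by rw [smul_eq_mul, mul_smul]; exact K.smul_mem _ ha.2⟩ }
  have hI : IsUniserial A I := by
    refine isUniserial_of_forall_smul ?_
    rintro ⟨a, ha⟩ ⟨b, hb⟩
    obtain ⟨c, hc⟩ := hf.left a b
    rw [ha.1, hb.1] at hc
    exact ⟨c, hc.imp (fun hc => Subtype.ext hc) (fun hc => Subtype.ext hc)⟩
  have hmem : ∀ a : A, a • z ∈ K → a * f ∈ I := fun a ha =>
    ⟨by rw [mul_assoc, hf.idem], by rwa [mul_smul, hz]⟩
  rcases subsingleton_or_nontrivial I with hs | hn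
  · refine ⟨0, zero_mem _, fun a h => ?_⟩
    have h0 : a * f = 0 := congrArg Subtype.val (hs.elim ⟨a * f, hmem a h⟩ 0)
    have h1 : a • z = 0 := by rw [← hz, ← mul_smul, h0, zero_smul]
    have h2 : (⟨a • z, h⟩ : K) = 0 := Subtype.ext h1
    rw [h2, map_zero, smul_zero]
  obtain ⟨g, hg, ⟨t, ht⟩, hgt, hspan⟩ := hI.exists_span_eq_top hA
  replace hgt : g * t = t := congrArg Subtype.val hgt
  have hgen : ∀ a : A, a • z ∈ K → ∃ b, a * f = b * t := fun a ha => by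
    obtain ⟨b, hb⟩ := Submodule.mem_span_singleton.1
      (hspan ▸ Submodule.mem_top : (⟨a * f, hmem a ha⟩ : I) ∈ _)
    exact ⟨b, (congrArg Subtype.val hb).symm⟩
  obtain ⟨s₀, hs₀⟩ := Submodule.mem_span_singleton.1 (hρ ⟨t • z, ht.2⟩)
  -- Since t = gt and x = ex, the value of ρ at tz is sx with s in gAe. Now s and t both lie in gA
  -- and can be compared there, while s can be compared with other elements of Ae.
  set s := g * s₀ * e with hs
  have hgs : g * s = s := by rw [hs, ← mul_assoc, ← mul_assoc, hg.idem]
  have hse : s * e = s := by rw [hs, mul_assoc, he.idem]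
  have hsx : ρ ⟨t • z, ht.2⟩ = s • x := by
    rw [hs, mul_smul, hx, mul_smul, hs₀, ← map_smul]
    congr 1
    exact Subtype.ext (by simp [← mul_smul, hgt])
  have hval : ∀ (a b : A) (h : a • z ∈ K), a * f = b * t → ρ ⟨a • z, h⟩ = b • s • x := by
    intro a b h hab
    rw [← hsx, ← map_smul]
    congr 1
    refine Subtype.ext ?_
    simp only [Submodule.coe_smul]
    rw [← mul_smul, ← hab, mul_smul, hz]
  clear_value s
  have key : (∃ c, s = t * c) ∨ ∃ c, t = s * c := by
    obtain ⟨c, hc | hc⟩ := hg.right s t <;> rw [hgs, hgt] at hc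
    exacts [.inl ⟨c, hc⟩, .inr ⟨c, hc⟩]
  rcases key with ⟨c, hc⟩ | ⟨c, hc⟩
  -- If s = tc, then z ↦ fcx works, because tf = t.
  · refine ⟨(f * c) • x, Submodule.smul_mem _ _ (Submodule.mem_span_singleton_self x),
      fun a h => ?_⟩
    obtain ⟨b, hb⟩ := hgen a h
    rw [hval a b h hb, hc, ← mul_smul, ← mul_smul, ← mul_assoc, ← hb, mul_assoc]
  -- If t = sc, then w is an element of Az fixed by e with sw = tz, so w ↦ x would have the right
  -- effect on tz.
  · set w := (e * c) • z with hw
    have hew : e • w = w := by rw [hw, ← mul_smul, ← mul_assoc, he.idem]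
    have hsw : s • w = t • z := by rw [hw, ← mul_smul, ← mul_assoc, hse, ← hc]
    -- When w ↦ x is well defined, Ax is a quotient of Aw ⊆ Az, and maximality of the length of Ax
    -- forces Aw = Az. Then z = dw is sent to dx.
    by_cases hann : ∀ a : A, a • w = 0 → a • x = 0
    · have hle : Submodule.span A {w} ≤ Submodule.span A {z} :=
        (Submodule.span_singleton_le_iff_mem _ _).2
          (Submodule.smul_mem _ _ (Submodule.mem_span_singleton_self z))
      have hxw : Module.length A (Submodule.span A {x}) ≤
          Module.length A (Submodule.span A {w}) := by
        obtain ⟨φ, hφ⟩ := exists_linearMap_span_of_annihilator_le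
          (y := (⟨x, Submodule.mem_span_singleton_self x⟩ : Submodule.span A {x}))
          (fun a ha => Subtype.ext (hann a ha))
        refine Module.length_le_of_surjective φ ?_
        rintro ⟨y, hy⟩
        obtain ⟨a, rfl⟩ := Submodule.mem_span_singleton.1 hy
        exact ⟨⟨a • w, Submodule.smul_mem _ _ (Submodule.mem_span_singleton_self w)⟩, hφ a _⟩
      have hzw : z ∈ Submodule.span A {w} := by
        have heq : Submodule.span A {w} = Submodule.span A {z} := by
          by_contra hne
          have hlt := Submodule.height_strictMono (lt_of_le_of_ne hle hne)
          rw [← Module.length_submodule, ← Module.length_submodule] at hlt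
          exact absurd (hlt.trans_le ((hmax f hf z hz).trans hxw)) (lt_irrefl _)
        exact heq ▸ Submodule.mem_span_singleton_self z
      obtain ⟨d, hd⟩ := Submodule.mem_span_singleton.1 hzw
      refine ⟨d • x, Submodule.smul_mem _ _ (Submodule.mem_span_singleton_self x),
        fun a h => ?_⟩
      obtain ⟨b, hb⟩ := hgen a h
      rw [hval a b h hb, ← sub_eq_zero, ← mul_smul, ← mul_smul, ← sub_smul]
      apply hann
      rw [sub_smul, mul_smul, mul_smul, hsw, hd, ← mul_smul, ← hb, mul_smul, hz, sub_self]
    · push Not at hann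
      obtain ⟨r, hrw, hrx⟩ := hann
      -- Compare re with s in Ae. If re = qs, then qtz = rw = 0, and applying ρ gives rx = 0, a
      -- contradiction. If s = q(re), then tz = sw = 0. With sx = 0, the choice u = 0 works.
      have hs0 : s • x = 0 := by
        obtain ⟨q, hq | hq⟩ := he.left r s <;> rw [hse] at hq
        · exfalso
          apply hrx
          have h1 : (q * t) • z = 0 := by
            rw [mul_smul, ← hsw, ← mul_smul, ← hq, mul_smul, hew, hrw]
          have h2 : q • (⟨t • z, ht.2⟩ : K) = 0 := Subtype.ext (by simpa [mul_smul] using h1)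
          have h3 := congrArg ρ h2
          rwa [map_smul, hsx, ← mul_smul, ← hq, mul_smul, hx, map_zero] at h3
        · have h1 : t • z = 0 := by
            rw [← hsw, hq, mul_smul, mul_smul, hew, hrw, smul_zero]
          have h2 : (⟨t • z, ht.2⟩ : K) = 0 := Subtype.ext h1
          rw [← hsx, h2, map_zero]
      refine ⟨0, zero_mem _, fun a h => ?_⟩
      obtain ⟨b, hb⟩ := hgen a h
      rw [hval a b h hb, hs0, smul_zero, smul_zero]

/-- A Baer-type argument: among submodules to which the identity of Ax extends with values in Ax,
take a maximal one; the extension step shows that it is all of M. -/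
theorem exists_retraction [IsArtinianRing A] [IsNoetherianRing A] [Module.Finite A M]
    (hA : Ideal.span {e : A | IsBiserialIdempotent e} = ⊤)
    {e : A} (he : IsBiserialIdempotent e) {x : M} (hx : e • x = x)
    (hmax : ∀ g : A, IsBiserialIdempotent g → ∀ y : M, g • y = y →
      Module.length A (Submodule.span A {y}) ≤ Module.length A (Submodule.span A {x})) :
    ∃ ρ : M →ₗ[A] M, (∀ y, ρ y ∈ Submodule.span A {x}) ∧ ρ x = x := by
  let P : Set (Submodule A M) := {K | ∃ ρ : K →ₗ[A] M,
    (∀ k, ρ k ∈ Submodule.span A {x}) ∧ ∃ h : x ∈ K, ρ ⟨x, h⟩ = x}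
  have hP : P.Nonempty := ⟨Submodule.span A {x}, Submodule.subtype _, fun k => k.2,
    Submodule.mem_span_singleton_self x, rfl⟩
  obtain ⟨K, ⟨ρ, hρ, hxK, hρx⟩, hKmax⟩ := WellFounded.has_min
    (wellFounded_gt (α := Submodule A M)) P hP
  have hK : K = ⊤ := by
    by_contra hK
    obtain ⟨f, hf, z, hz, hfz⟩ := exists_smul_notMem hA hK
    obtain ⟨u, hu, hau⟩ := exists_forall_smul_mem_eq hA he hf hx hfz hmax ρ hρ
    -- This makes the gluing of ρ on K with z ↦ u well defined on K + Az, presented as a quotient of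
    -- K × A.
    have hker : LinearMap.ker (K.subtype.coprod (LinearMap.toSpanSingleton A M z)) ≤
        LinearMap.ker (ρ.coprod (LinearMap.toSpanSingleton A M u)) := by
      rintro ⟨k, a⟩ hka
      have h1 : (k : M) + a • z = 0 := by simpa using hka
      have h2 : a • z = ((-k : K) : M) := by
        rw [Submodule.coe_neg]; exact eq_neg_of_add_eq_zero_right h1
      have h3 := hau a (h2 ▸ (-k).2)
      have h4 : (⟨a • z, h2 ▸ (-k).2⟩ : K) = -k := Subtype.ext h2
      rw [h4, map_neg] at h3
      simp [← h3]
    set φ := K.subtype.coprod (LinearMap.toSpanSingleton A M z) with hφ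
    let ψ : LinearMap.range φ →ₗ[A] M :=
      (Submodule.liftQ _ _ hker).comp φ.quotKerEquivRange.symm.toLinearMap
    have hψ : ∀ p h, ψ ⟨φ p, h⟩ = ρ p.1 + p.2 • u := by
      intro p h
      have : φ.quotKerEquivRange.symm ⟨φ p, h⟩ = Submodule.Quotient.mk p := by
        rw [LinearEquiv.symm_apply_eq]
        rfl
      simp [ψ, this]
    have hKr : ∀ k (hk : k ∈ K), φ (⟨k, hk⟩, 0) = k := fun k hk => by simp [hφ]
    refine hKmax (LinearMap.range φ) ⟨ψ, ?_, ⟨(⟨x, hxK⟩, 0), hKr x hxK⟩, ?_⟩ ?_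
    · rintro ⟨_, p, rfl⟩
      rw [hψ p (LinearMap.mem_range_self φ p)]
      exact Submodule.add_mem _ (hρ _) (Submodule.smul_mem _ _ hu)
    · have := hψ (⟨x, hxK⟩, 0) ⟨_, rfl⟩
      simp only [hKr, zero_smul, add_zero, hρx] at this
      exact this
    · refine lt_of_le_of_ne (fun k hk => ⟨(⟨k, hk⟩, 0), hKr k hk⟩) ?_
      intro heq
      exact hz (heq ▸ ⟨(0, 1), by simp [hφ]⟩)
  subst hK
  exact ⟨ρ.comp Submodule.topEquiv.symm.toLinearMap, fun y => hρ _, hρx⟩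

/-- A nonzero finitely generated module without nontrivial idempotent endomorphisms is cyclic,
generated by an element fixed by a biserial idempotent. -/
theorem exists_span_eq_top_of_idempotents [IsArtinianRing A] [IsNoetherianRing A]
    [Module.Finite A M] [Nontrivial M]
    (hA : Ideal.span {e : A | IsBiserialIdempotent e} = ⊤)
    (hM : ∀ ρ : M →ₗ[A] M, ρ ∘ₗ ρ = ρ → ρ = 0 ∨ ρ = LinearMap.id) :
    ∃ e : A, IsBiserialIdempotent e ∧ ∃ x : M, e • x = x ∧ Submodule.span A {x} = ⊤ := by
  -- These lengths are bounded by the finite length of M, so a largest one exists; excluding x = 0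
  -- keeps the resulting retraction nonzero.
  let L : Set ℕ∞ := {n | ∃ e : A, IsBiserialIdempotent e ∧ ∃ x : M, x ≠ 0 ∧ e • x = x ∧
    n = Module.length A (Submodule.span A {x})}
  obtain ⟨e₀, he₀, z, hz, hez⟩ := exists_smul_notMem hA (bot_ne_top (α := Submodule A M))
  have hL : L.Nonempty := ⟨_, e₀, he₀, z, by simpa using hz, hez, rfl⟩
  have hfin : Module.length A M ≠ ⊤ := Module.length_ne_top
  have hle : ∀ n ∈ L, n ≤ Module.length A M := by
    rintro _ ⟨e, he, x, -, -, rfl⟩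
    exact Module.length_le_of_injective (Submodule.subtype _) (Submodule.subtype_injective _)
  have hLfin : L.Finite := by
    obtain ⟨n, hn⟩ := ENat.ne_top_iff_exists.1 hfin
    refine ((Set.finite_Iic n).image ((↑) : ℕ → ℕ∞)).subset fun k hk => ?_
    have := hle k hk
    rw [← hn] at this
    lift k to ℕ using ne_top_of_le_ne_top (by simp) this
    exact ⟨k, by simpa using this, rfl⟩
  obtain ⟨_, ⟨⟨e, he, x, hx0, hx, rfl⟩, hmax⟩⟩ := hLfin.exists_maximal hL
  obtain ⟨ρ, hρ, hρx⟩ := exists_retraction hA he hx (fun g hg y hy => by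
    by_cases hy0 : y = 0
    · rw [hy0, Submodule.span_zero_singleton, Module.length_bot]
      exact zero_le
    · exact (le_total _ _).elim id (hmax ⟨g, hg, y, hy0, hy, rfl⟩))
  have hρρ : ρ ∘ₗ ρ = ρ := by
    ext y
    obtain ⟨a, ha⟩ := Submodule.mem_span_singleton.1 (hρ y)
    simp [← ha, hρx]
  refine ⟨e, he, x, hx, ?_⟩
  rcases hM ρ hρρ with h | h
  · exact absurd (by simpa [h] using hρx.symm) hx0
  · rw [eq_top_iff]
    intro y _
    simpa [h] using hρ y

/-- Kernel and range of an idempotent are complementary, yet comparable here, so one of them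
vanishes. -/
theorem IsUniserial.idempotent_eq (h : IsUniserial A M) (ρ : M →ₗ[A] M) (hρ : ρ ∘ₗ ρ = ρ) :
    ρ = 0 ∨ ρ = LinearMap.id := by
  have hρ' : ∀ x, ρ (ρ x) = ρ x := fun x => LinearMap.congr_fun hρ x
  rcases h (LinearMap.ker ρ) (LinearMap.range ρ) with h | h
  · right
    ext x
    have h1 : x - ρ x ∈ LinearMap.ker ρ := by simp [hρ']
    obtain ⟨y, hy⟩ := h h1
    have h2 : ρ (x - ρ x) = 0 := h1
    rw [← hy, hρ', hy, sub_eq_zero] at h2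
    exact h2.symm
  · left
    ext x
    have : ρ (ρ x) = 0 := h ⟨x, rfl⟩
    rwa [hρ'] at this

theorem IsUniserial.eq_of_isCoatom (h : IsUniserial A M) {K L : Submodule A M}
    (hK : IsCoatom K) (hL : IsCoatom L) : K = L := by
  rcases h K L with h | h
  · exact (hK.le_iff_eq hL.1).1 h |>.symm
  · exact (hL.le_iff_eq hK.1).1 h

theorem IsUniserial.isCoatom_jacobson [Module.Finite A M] [Nontrivial M] (h : IsUniserial A M) :
    IsCoatom (Module.jacobson A M) := by
  obtain ⟨K, hK, -⟩ := (eq_top_or_exists_le_coatom (⊥ : Submodule A M)).resolve_left bot_ne_top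
  have : Module.jacobson A M = K :=
    le_antisymm (sInf_le hK) (le_sInf fun L hL => (h.eq_of_isCoatom hK hL).le)
  rwa [this]

end Serial

/-! ### Translation between categorical notions and linear algebra -/

section ModuleCategory

variable {B : Type u} [Ring B] {X Y Z : FGModuleCat.{u} B}

/-- The underlying linear map of a morphism of finitely generated modules. -/
abbrev toLinear (f : X ⟶ Y) : X →ₗ[B] Y := f.hom.hom

/-- A linear map as a morphism of finitely generated modules. -/
abbrev ofLinear (f : X →ₗ[B] Y) : X ⟶ Y := ObjectProperty.homMk (ModuleCat.ofHom f)

theorem toLinear_injective {f g : X ⟶ Y} (h : toLinear f = toLinear g) : f = g :=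
  FGModuleCat.hom_ext h

theorem toLinear_comp_apply (f : X ⟶ Y) (g : Y ⟶ Z) (x : X) :
    toLinear (f ≫ g) x = toLinear g (toLinear f x) := rfl

/-- A linear equivalence as an isomorphism of finitely generated modules. -/
def isoOfLinearEquiv (e : X ≃ₗ[B] Y) : X ≅ Y where
  hom := ofLinear e.toLinearMap
  inv := ofLinear e.symm.toLinearMap
  hom_inv_id := toLinear_injective (by ext x; exact e.left_inv x)
  inv_hom_id := toLinear_injective (by ext x; exact e.right_inv x)

theorem isZero_iff_subsingleton : IsZero X ↔ Subsingleton X := by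
  rw [IsZero.iff_id_eq_zero]
  constructor
  · intro h
    refine subsingleton_of_forall_eq 0 fun x => ?_
    exact LinearMap.congr_fun (congrArg toLinear h) x
  · intro h
    exact toLinear_injective (by ext x; exact Subsingleton.elim _ _)

theorem not_isZero_iff_nontrivial : ¬ IsZero X ↔ Nontrivial X := by
  rw [isZero_iff_subsingleton, not_subsingleton_iff_nontrivial]

theorem mono_of_injective (f : X ⟶ Y) (h : Function.Injective (toLinear f)) : Mono f where
  right_cancellation g k hgk := toLinear_injective <| by
    ext x
    exact h (LinearMap.congr_fun (congrArg toLinear hgk) x)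

theorem epi_of_surjective (f : X ⟶ Y) (h : Function.Surjective (toLinear f)) : Epi f where
  left_cancellation g k hgk := toLinear_injective <| by
    ext y
    obtain ⟨x, rfl⟩ := h y
    exact LinearMap.congr_fun (congrArg toLinear hgk) x

theorem injective_of_mono (f : X ⟶ Y) [Mono f] : Function.Injective (toLinear f) := by
  rw [injective_iff_map_eq_zero]
  intro x hx
  let k : FGModuleCat.of B B ⟶ X := ofLinear (LinearMap.toSpanSingleton B X x)
  have hk : k ≫ f = 0 := toLinear_injective <| LinearMap.ext_ring <| by
    change toLinear f ((1 : B) • x) = 0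
    rw [one_smul, hx]
  have hk0 : k = 0 := by rw [← cancel_mono f, hk, zero_comp]
  have : (1 : B) • x = 0 := LinearMap.congr_fun (congrArg toLinear hk0) (1 : B)
  rwa [one_smul] at this

theorem surjective_of_epi (f : X ⟶ Y) [Epi f] : Function.Surjective (toLinear f) := by
  let q : Y ⟶ FGModuleCat.of B (Y ⧸ LinearMap.range (toLinear f)) :=
    ofLinear (Submodule.mkQ (LinearMap.range (toLinear f)))
  have hq : f ≫ q = 0 := toLinear_injective <| by
    ext x
    exact (Submodule.Quotient.mk_eq_zero _).2 ⟨x, rfl⟩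
  have hq0 : q = 0 := by rw [← cancel_epi f, hq, comp_zero]
  intro y
  exact (Submodule.Quotient.mk_eq_zero _).1 (LinearMap.congr_fun (congrArg toLinear hq0) y)

/-- B is an arbitrary ring, so kernels need not be finitely generated in general. The zero homology
is therefore exhibited by hand, with the outer terms of S as kernel and cokernel. -/
theorem shortExact_of_linear {S : ShortComplex (FGModuleCat.{u} B)}
    (hf : Function.Injective (toLinear S.f)) (hg : Function.Surjective (toLinear S.g))
    (hfg : ∀ y, toLinear S.g y = 0 → ∃ x, toLinear S.f x = y) : S.ShortExact := by
  have := mono_of_injective _ hf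
  have := epi_of_surjective _ hg
  have hfS : ∀ x, toLinear S.g (toLinear S.f x) = 0 := fun x =>
    LinearMap.congr_fun (congrArg toLinear S.zero) x
  have hrange : LinearMap.range (toLinear S.f) = LinearMap.ker (toLinear S.g) := by
    ext y
    exact ⟨fun ⟨x, hx⟩ => hx ▸ hfS x, hfg y⟩
  let eK : S.X₁ ≃ₗ[B] LinearMap.ker (toLinear S.g) :=
    (LinearEquiv.ofInjective _ hf).trans (LinearEquiv.ofEq _ _ hrange)
  have heK : ∀ y, toLinear S.f (eK.symm y) = y := fun y =>
    congrArg Subtype.val (eK.apply_symm_apply y)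
  let eC : ((S.X₂ : Type u) ⧸ LinearMap.ker (toLinear S.g)) ≃ₗ[B] S.X₃ :=
    (toLinear S.g).quotKerEquivOfSurjective hg
  have hz : IsZero (FGModuleCat.of B PUnit.{u + 1}) :=
    isZero_iff_subsingleton.2 (inferInstanceAs (Subsingleton PUnit))
  have hS₁ : IsLimit (KernelFork.ofι S.f S.zero) :=
    KernelFork.IsLimit.ofι' _ _ fun {T} k hk => ⟨ofLinear (eK.symm.toLinearMap ∘ₗ
      (toLinear k).codRestrict _ fun x => LinearMap.congr_fun (congrArg toLinear hk) x),
      toLinear_injective (by ext x; exact heK _)⟩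
  have hS₃ : IsColimit (CokernelCofork.ofπ S.g S.zero) :=
    CokernelCofork.IsColimit.ofπ' _ _ fun {T} k hk =>
      have hle : LinearMap.ker (toLinear S.g) ≤ LinearMap.ker (toLinear k) := by
        rw [← hrange]
        rintro _ ⟨x, rfl⟩
        exact LinearMap.congr_fun (congrArg toLinear hk) x
      ⟨ofLinear ((Submodule.liftQ _ (toLinear k) hle) ∘ₗ eC.symm.toLinearMap),
      toLinear_injective (by
        ext x
        change Submodule.liftQ _ (toLinear k) hle (eC.symm (toLinear S.g x)) = toLinear k x
        have : eC.symm (toLinear S.g x) = Submodule.Quotient.mk x := by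
          rw [LinearEquiv.symm_apply_eq]
          rfl
        rw [this]
        rfl)⟩
  have h₁ : hS₁.lift (KernelFork.ofι _ S.zero) = 𝟙 _ := by
    rw [← cancel_mono S.f]
    exact (Fork.IsLimit.lift_ι hS₁).trans (Category.id_comp _).symm
  have h₃ : hS₃.desc (CokernelCofork.ofπ _ S.zero) = 𝟙 _ := by
    rw [← cancel_epi S.g]
    exact (Cofork.IsColimit.π_desc hS₃).trans (Category.comp_id _).symm
  have hepi : Epi (0 : S.X₁ ⟶ FGModuleCat.of B PUnit.{u + 1}) := ⟨fun _ _ _ => hz.eq_of_src _ _⟩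
  have hmono : Mono (0 : FGModuleCat.of B PUnit.{u + 1} ⟶ S.X₃) := ⟨fun _ _ _ => hz.eq_of_tgt _ _⟩
  let h : S.HomologyData :=
    { left :=
        { K := S.X₁
          H := FGModuleCat.of B PUnit
          i := S.f
          π := 0
          wi := S.zero
          hi := hS₁
          wπ := comp_zero
          hπ := CokernelCofork.IsColimit.ofπ' _ _ fun {T} k hk => ⟨0, by
            rw [zero_comp, ← hk, h₁]
            exact (Category.id_comp k).symm⟩ }
      right :=
        { Q := S.X₃
          H := FGModuleCat.of B PUnit
          p := S.g
          ι := 0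
          wp := S.zero
          hp := hS₃
          wι := zero_comp
          hι := KernelFork.IsLimit.ofι' _ _ fun {T} k hk => ⟨0, by
            rw [comp_zero, ← hk, h₃]
            exact (Category.comp_id k).symm⟩ }
      iso := Iso.refl _
      comm := by simp }
  exact { exact := ⟨⟨h, hz⟩⟩, mono_f := inferInstance, epi_g := inferInstance }

/-- An idempotent ρ splits X as range ρ ⊕ range (1 - ρ); closure of E under submodules puts both
summands in E. -/
theorem IsIndecomposable.idempotent_eq {E : ObjectProperty (FGModuleCat.{u} B)}
    (hE : ∀ ⦃X Y : FGModuleCat.{u} B⦄ (f : X →ₗ[B] Y), Function.Injective f → E Y → E X)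
    (hX : IsIndecomposable E X) (ρ : X →ₗ[B] X) (hρ : ρ ∘ₗ ρ = ρ) :
    ρ = 0 ∨ ρ = LinearMap.id := by
  have hρ' : ∀ x, ρ (ρ x) = ρ x := fun x => LinearMap.congr_fun hρ x
  let Y : FGModuleCat B := FGModuleCat.of B (LinearMap.range ρ)
  let σ : X →ₗ[B] X := LinearMap.id - ρ
  have hσ : ∀ x, σ (σ x) = σ x := fun x => by simp [σ, hρ']
  let Z : FGModuleCat B := FGModuleCat.of B (LinearMap.range σ)
  let b : BinaryBicone Y Z :=
    { pt := X
      fst := ofLinear (Y := Y) ρ.rangeRestrict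
      snd := ofLinear (Y := Z) σ.rangeRestrict
      inl := ofLinear (X := Y) (Submodule.subtype _)
      inr := ofLinear (X := Z) (Submodule.subtype _)
      inl_fst := toLinear_injective <| by
        refine LinearMap.ext ?_
        rintro ⟨_, x, rfl⟩
        exact Subtype.ext (hρ' x)
      inl_snd := toLinear_injective <| by
        refine LinearMap.ext ?_
        rintro ⟨_, x, rfl⟩
        exact Subtype.ext (show ρ x - ρ (ρ x) = 0 by rw [hρ', sub_self])
      inr_fst := toLinear_injective <| by
        refine LinearMap.ext ?_
        rintro ⟨_, x, rfl⟩
        exact Subtype.ext (show ρ (x - ρ x) = 0 by rw [map_sub, hρ', sub_self])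
      inr_snd := toLinear_injective <| by
        refine LinearMap.ext ?_
        rintro ⟨_, x, rfl⟩
        exact Subtype.ext (hσ x) }
  have hb : b.IsBilimit := isBinaryBilimitOfTotal b <| toLinear_injective <| by
    ext x
    exact add_sub_cancel (ρ x) x
  have hY : E Y := hE (Submodule.subtype _) (Submodule.subtype_injective _) hX.1
  have hZ : E Z := hE (Submodule.subtype _) (Submodule.subtype_injective _) hX.1
  rcases hX.2.2 Y Z hY hZ b ⟨hb⟩ ⟨Iso.refl X⟩ with h | h
  · left
    ext x
    exact congrArg Subtype.val
      ((isZero_iff_subsingleton.1 h).elim (⟨ρ x, x, rfl⟩ : LinearMap.range ρ) 0)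
  · right
    ext x
    have : x - ρ x = 0 := congrArg Subtype.val
      ((isZero_iff_subsingleton.1 h).elim (⟨σ x, x, rfl⟩ : LinearMap.range σ) 0)
    exact (sub_eq_zero.1 this).symm

theorem isIndecomposable_of_idempotents {E : ObjectProperty (FGModuleCat.{u} B)} (hX : E X)
    (hn : Nontrivial X)
    (h : ∀ ρ : X →ₗ[B] X, ρ ∘ₗ ρ = ρ → ρ = 0 ∨ ρ = LinearMap.id) : IsIndecomposable E X := by
  refine ⟨hX, not_isZero_iff_nontrivial.2 hn, fun Y Z _ _ b _ ⟨φ⟩ => ?_⟩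
  let r : X ⟶ X := φ.hom ≫ (b.fst ≫ b.inl) ≫ φ.inv
  have hr : r ≫ r = r := by simp [r]
  have hb : b.fst ≫ b.inl = φ.inv ≫ r ≫ φ.hom := by simp [r]
  rcases h (toLinear r) (congrArg toLinear hr) with h | h
  · left
    have hr0 : r = 0 := toLinear_injective h
    rw [IsZero.iff_id_eq_zero]
    calc 𝟙 Y = b.inl ≫ (b.fst ≫ b.inl) ≫ b.fst := by simp
      _ = 0 := by rw [hb, hr0]; simp
  · right
    have hr1 : r = 𝟙 X := toLinear_injective h
    rw [IsZero.iff_id_eq_zero]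
    calc 𝟙 Z = b.inr ≫ b.snd := by simp
      _ = b.inr ≫ (φ.inv ≫ r ≫ φ.hom) ≫ b.snd := by rw [hr1]; simp
      _ = 0 := by rw [← hb]; simp

/-- The torsion part of X maps to zero in Y, hence already in X, so X is isomorphic to its
torsion-free quotient. -/
theorem IsTorsionFreeClass.of_injective {F : ObjectProperty (FGModuleCat.{u} B)}
    (hF : IsTorsionFreeClass F) (f : X →ₗ[B] Y) (hf : Function.Injective f) (hY : F Y) :
    F X := by
  obtain ⟨T, hT⟩ := hF
  obtain ⟨T', F', i, p, h, hT', hF', hex⟩ := hT.exists_shortExact X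
  have hmono : Mono (ofLinear f) := mono_of_injective _ hf
  have hi : i = 0 := by
    rw [← cancel_mono (ofLinear f), hT.hom_eq_zero hT' hY (i ≫ ofLinear f), zero_comp]
  have hp : Mono p := hex.exact.mono_g hi
  have hp' : Epi p := hex.epi_g
  have := hT.closed_right
  exact F.prop_of_iso (isoOfLinearEquiv (LinearEquiv.ofBijective (toLinear p)
    ⟨injective_of_mono p, surjective_of_epi p⟩)).symm hF'

theorem IsTorsionFreeClass.isClosedUnderIsomorphisms {F : ObjectProperty (FGModuleCat.{u} B)}
    (hF : IsTorsionFreeClass F) : F.IsClosedUnderIsomorphisms :=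
  hF.elim fun _ hT => hT.closed_right

end ModuleCategory

/-! ### Primitive idempotents in a Nakayama algebra -/

section PrimitiveIdempotents

/-- A nonzero idempotent that does not split as a sum of two nonzero orthogonal idempotents. -/
structure IsPrimitiveIdempotent {B : Type*} [Ring B] (e : B) : Prop where
  idem : e * e = e
  ne_zero : e ≠ 0
  eq_or : ∀ f, f * f = f → e * f = f → f * e = f → f = 0 ∨ f = e

/-- Be is a summand of B, hence projective. An idempotent endomorphism ρ is right multiplication by
ρ(e), an idempotent of eBe, so primitivity of e makes Be indecomposable and the hypothesis on
projectives applies. -/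
theorem IsPrimitiveIdempotent.exists_mul_eq {B : Type u} [Ring B] {e : B}
    (he : IsPrimitiveIdempotent e) (hB : ProjectivesUniserial B) (a b : B) :
    ∃ c, a * e = c * (b * e) ∨ b * e = c * (a * e) := by
  let P : FGModuleCat.{u} B := FGModuleCat.of B (Submodule.span B {e})
  let ε : Submodule.span B {e} := ⟨e, Submodule.mem_span_singleton_self e⟩
  have hmem : ∀ x : Submodule.span B {e}, x = (x : B) • ε ∧ (x : B) * e = x := by
    rintro ⟨x, hx⟩
    obtain ⟨c, rfl⟩ := Submodule.mem_span_singleton.1 hx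
    have : c • e * e = c • e := by rw [smul_eq_mul, mul_assoc, he.idem]
    exact ⟨Subtype.ext this.symm, this⟩
  have hP : IsIndecomposable ⊤ P := by
    refine isIndecomposable_of_idempotents trivial
      ⟨⟨ε, 0, fun h => he.ne_zero (congrArg Subtype.val h)⟩⟩ ?_
    intro (ρ : Submodule.span B {e} →ₗ[B] Submodule.span B {e}) hρ
    have hρ' : ∀ x, ρ (ρ x) = ρ x := fun x => LinearMap.congr_fun hρ x
    have h1 : ((ρ ε : B)) * e = ρ ε := (hmem _).2
    have h2 : e * (ρ ε : B) = ρ ε := by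
      have : e • ρ ε = ρ ε := by rw [← map_smul, ← (hmem ε).1]
      exact congrArg Subtype.val this
    have h3 : (ρ ε : B) * (ρ ε : B) = ρ ε := by
      have : (ρ ε : B) • ρ ε = ρ ε := by rw [← map_smul, ← (hmem (ρ ε)).1, hρ']
      exact congrArg Subtype.val this
    refine (he.eq_or _ h3 h2 h1).imp (fun h => ?_) (fun h => ?_)
    · have : ρ ε = 0 := Subtype.ext h
      refine LinearMap.ext fun x => ?_
      rw [(hmem x).1, map_smul, this, smul_zero]
      rfl
    · have : ρ ε = ε := Subtype.ext h
      refine LinearMap.ext fun x => ?_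
      rw [(hmem x).1, map_smul, this]
      rfl
  have hproj : Module.Projective B P := by
    refine Module.Projective.of_split (M := B) (Submodule.subtype _)
      (LinearMap.toSpanSingleton B (Submodule.span B {e}) ε) ?_
    refine LinearMap.ext fun x => ?_
    exact (hmem x).1.symm
  obtain ⟨c, hc⟩ := (hB P hP hproj).exists_smul (a • ε) (b • ε)
  exact ⟨c, hc.imp (congrArg Subtype.val) (congrArg Subtype.val)⟩

/-- Well-founded induction on the left ideal Be: a nonprimitive e ≠ 0 is f + (e - f), and both
summands generate strictly smaller left ideals. -/
theorem span_isPrimitiveIdempotent (B : Type*) [Ring B] [IsArtinianRing B] :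
    Ideal.span {e : B | IsPrimitiveIdempotent e} = ⊤ := by
  suffices h : ∀ I : Ideal B, ∀ e : B, I = Ideal.span {e} → e * e = e →
      e ∈ Ideal.span {e : B | IsPrimitiveIdempotent e} from
    (Ideal.eq_top_iff_one _).2 (h _ 1 rfl (one_mul 1))
  intro I
  induction I using WellFoundedLT.induction with
  | ind I ih =>
  rintro e rfl he
  by_cases he0 : e = 0
  · simp [he0]
  by_cases hp : IsPrimitiveIdempotent e
  · exact Ideal.subset_span hp
  obtain ⟨f, hff, hef, hfe, hf0, hfne⟩ :
      ∃ f, f * f = f ∧ e * f = f ∧ f * e = f ∧ f ≠ 0 ∧ f ≠ e := by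
    by_contra! h
    exact hp ⟨he, he0, fun f h1 h2 h3 => or_iff_not_imp_left.2 (h f h1 h2 h3)⟩
  have hlt : ∀ f, f * f = f → e * f = f → f * e = f → f ≠ e →
      f ∈ Ideal.span {e : B | IsPrimitiveIdempotent e} := by
    intro f hff hef hfe hfne
    refine ih (Ideal.span {f}) (lt_of_le_of_ne ?_ ?_) f rfl hff
    · rw [Ideal.span_singleton_le_iff_mem, Ideal.mem_span_singleton']
      exact ⟨f, hfe⟩
    · intro h
      obtain ⟨a, ha⟩ := Ideal.mem_span_singleton'.1
        (h ▸ Ideal.mem_span_singleton_self e : e ∈ Ideal.span {f})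
      apply hfne
      rw [← hef, ← ha, mul_assoc, hff]
  have hg := hlt (e - f) (by simp [mul_sub, sub_mul, he, hef, hfe, hff])
    (by simp [mul_sub, he, hef]) (by simp [sub_mul, he, hfe]) (by simpa using hf0)
  simpa using Ideal.add_mem _ hg (hlt f hff hef hfe hfne)

theorem IsNakayama.span_isBiserialIdempotent {Λ : Type u} [Ring Λ] [IsArtinianRing Λᵐᵒᵖ]
    (hΛ : IsNakayama Λ) : Ideal.span {e : Λᵐᵒᵖ | IsBiserialIdempotent e} = ⊤ := by
  rw [eq_top_iff, ← span_isPrimitiveIdempotent]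
  refine Ideal.span_mono fun e he => ⟨he.idem, he.exists_mul_eq hΛ.1, fun a b => ?_⟩
  -- Primitivity is left-right symmetric, so uniseriality of the left projectives of Λ gives the
  -- comparison in e Λᵐᵒᵖ.
  have he' : IsPrimitiveIdempotent e.unop :=
    ⟨congrArg MulOpposite.unop he.idem, fun h => he.ne_zero (MulOpposite.unop_injective h),
      fun f h1 h2 h3 => (he.eq_or (MulOpposite.op f) (congrArg MulOpposite.op h1)
        (congrArg MulOpposite.op h3) (congrArg MulOpposite.op h2)).imp
        (congrArg MulOpposite.unop) (congrArg MulOpposite.unop)⟩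
  obtain ⟨c, hc⟩ := he'.exists_mul_eq hΛ.2 a.unop b.unop
  exact ⟨MulOpposite.op c, hc.imp (congrArg MulOpposite.op) (congrArg MulOpposite.op)⟩

end PrimitiveIdempotents

/-! ### Uniserial modules with a common top -/

section UniserialModules

variable {A : Type*} [Ring A] {M : Type*} [AddCommGroup M] [Module A M]
  {N : Type*} [AddCommGroup N] [Module A N]

theorem surjective_of_span_eq_top {f : M →ₗ[A] N} {x : M}
    (h : Submodule.span A {f x} = ⊤) : Function.Surjective f := by
  rw [← LinearMap.range_eq_top, eq_top_iff, ← h, Submodule.span_singleton_le_iff_mem]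
  exact ⟨x, rfl⟩

theorem injective_of_length_le [IsArtinian A M] [IsNoetherian A M] {f : M →ₗ[A] N}
    (hf : Function.Surjective f) (h : Module.length A M ≤ Module.length A N) :
    Function.Injective f := by
  rw [← LinearMap.ker_eq_bot]
  by_contra hk
  have := Submodule.length_quotient_lt _ hk
  rw [(f.quotKerEquivOfSurjective hf).length_eq] at this
  exact absurd (this.trans_le h) (lt_irrefl _)

/-- Two uniserial modules with isomorphic tops are generated by elements which are fixed by the
same biserial idempotent. -/
theorem IsUniserial.exists_common_idempotent [Module.Finite A M] [Nontrivial M]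
    [Module.Finite A N] [Nontrivial N]
    (hA : Ideal.span {e : A | IsBiserialIdempotent e} = ⊤)
    (hM : IsUniserial A M) (hN : IsUniserial A N)
    (φ : (M ⧸ Module.jacobson A M) ≃ₗ[A] (N ⧸ Module.jacobson A N)) :
    ∃ e : A, IsBiserialIdempotent e ∧ ∃ (x : M) (y : N), e • x = x ∧ e • y = y ∧
      Submodule.span A {x} = ⊤ ∧ Submodule.span A {y} = ⊤ := by
  obtain ⟨e, he, x, hex, hx⟩ := hM.exists_span_eq_top hA
  obtain ⟨y, hy⟩ := Submodule.Quotient.mk_surjective _ (φ (Submodule.Quotient.mk x))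
  -- The class of ey in the top is still φ of the class of x, because ex = x; being nonzero there,
  -- ey generates N.
  refine ⟨e, he, x, e • y, hex, by rw [← mul_smul, he.idem], hx,
    hN.span_singleton_eq_top hN.isCoatom_jacobson fun hmem => ?_⟩
  rw [← Submodule.Quotient.mk_eq_zero, Submodule.Quotient.mk_smul, hy, ← map_smul,
    ← Submodule.Quotient.mk_smul, hex, LinearEquiv.map_eq_zero_iff,
    Submodule.Quotient.mk_eq_zero, ← Submodule.span_singleton_le_iff_mem, hx, top_le_iff] at hmem
  exact hM.isCoatom_jacobson.1 hmem

theorem IsUniserial.exists_surjective [IsArtinianRing A] [IsNoetherianRing A]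
    [Module.Finite A M] [Nontrivial M] [Module.Finite A N] [Nontrivial N]
    (hA : Ideal.span {e : A | IsBiserialIdempotent e} = ⊤)
    (hM : IsUniserial A M) (hN : IsUniserial A N)
    (φ : (M ⧸ Module.jacobson A M) ≃ₗ[A] (N ⧸ Module.jacobson A N))
    (h : Module.length A N ≤ Module.length A M) :
    ∃ f : M →ₗ[A] N, Function.Surjective f := by
  obtain ⟨e, he, x, y, hex, hey, hx, hy⟩ := hM.exists_common_idempotent hA hN φ
  rcases he.annihilator_le_or hex hey with hann | hann
  · obtain ⟨f, rfl⟩ := exists_linearMap_of_annihilator_le hx hann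
    exact ⟨f, surjective_of_span_eq_top hy⟩
  · obtain ⟨f, rfl⟩ := exists_linearMap_of_annihilator_le hy hann
    have hf : Function.Surjective f := surjective_of_span_eq_top hx
    exact ⟨(LinearEquiv.ofBijective f ⟨injective_of_length_le hf h, hf⟩).symm.toLinearMap,
      LinearEquiv.surjective _⟩

/-- The kernel is proper, so it lies in the unique maximal submodule of M, and passing to the
quotient does not change the top. -/
theorem IsUniserial.nonempty_quotient_jacobson_equiv [Module.Finite A M] [Nontrivial M]
    [Nontrivial N] (hM : IsUniserial A M) (f : M →ₗ[A] N) (hf : Function.Surjective f) :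
    Nonempty ((M ⧸ Module.jacobson A M) ≃ₗ[A] (N ⧸ Module.jacobson A N)) := by
  have hker : LinearMap.ker f ≠ ⊤ := by
    intro h
    obtain ⟨y, hy⟩ := exists_ne (0 : N)
    obtain ⟨x, rfl⟩ := hf y
    exact hy (LinearMap.mem_ker.1 (h ▸ Submodule.mem_top))
  have hle : LinearMap.ker f ≤ Module.jacobson A M := by
    rcases hM (LinearMap.ker f) (Module.jacobson A M) with h | h
    · exact h
    · exact ((hM.isCoatom_jacobson.le_iff_eq hker).1 h).le
  let g : M →ₗ[A] N ⧸ Module.jacobson A N := (Module.jacobson A N).mkQ ∘ₗ f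
  have hg : Function.Surjective g := (Submodule.mkQ_surjective _).comp hf
  have hgk : Module.jacobson A M = LinearMap.ker g := by
    rw [LinearMap.ker_comp, Submodule.ker_mkQ, Module.comap_jacobson_of_ker_le hf hle]
  exact ⟨(Submodule.quotEquivOfEq _ _ hgk).trans (g.quotKerEquivOfSurjective hg)⟩

end UniserialModules

/-! ### Simple and projective objects of a torsion-free class -/

section TorsionFreeClasses

variable {A : Type u} [Ring A] {F : ObjectProperty (FGModuleCat.{u} A)}
  {M N S : FGModuleCat.{u} A}

theorem isConflation_of_surjective [IsNoetherianRing A] (hF : IsTorsionFreeClass F) (hM : F M)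
    (hN : F N) (f : M →ₗ[A] N) (hf : Function.Surjective f) :
    ∃ h, IsConflation F (ShortComplex.mk
      (ofLinear (X := FGModuleCat.of A (LinearMap.ker f)) (LinearMap.ker f).subtype)
      (ofLinear f) h) := by
  refine ⟨toLinear_injective (by ext x; exact x.2), ?_, ?_, hM, hN⟩
  · exact shortExact_of_linear (Submodule.subtype_injective _) hf fun y hy => ⟨⟨y, hy⟩, rfl⟩
  · exact hF.of_injective (X := FGModuleCat.of A (LinearMap.ker f)) (LinearMap.ker f).subtype
      (Submodule.subtype_injective _) hM

/-- An object of a torsion-free class is simple if and only if it is nonzero and has no proper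
nonzero quotient in the class. -/
theorem isSimpleObject_iff [IsNoetherianRing A] (hF : IsTorsionFreeClass F) :
    IsSimpleObject F M ↔ F M ∧ Nontrivial M ∧ ∀ (N : FGModuleCat.{u} A) (f : M →ₗ[A] N),
      F N → Nontrivial N → Function.Surjective f → Function.Injective f := by
  refine ⟨fun ⟨hM, h0, h⟩ => ⟨hM, not_isZero_iff_nontrivial.1 h0, fun N f hN hn hf => ?_⟩,
    fun ⟨hM, hn, h⟩ => ⟨hM, not_isZero_iff_nontrivial.2 hn, fun L N i p hip hc => ?_⟩⟩
  · obtain ⟨h', hc⟩ := isConflation_of_surjective hF hM hN f hf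
    rcases h _ _ _ _ h' hc with h | h
    · rw [← LinearMap.ker_eq_bot, ← Submodule.subsingleton_iff_eq_bot]
      exact isZero_iff_subsingleton.1 h
    · exact absurd h (not_isZero_iff_nontrivial.2 hn)
  · rw [or_iff_not_imp_right]
    intro hN
    have := hc.1.mono_f
    have := hc.1.epi_g
    have hp := h N (toLinear p) hc.2.2.2 (not_isZero_iff_nontrivial.1 hN) (surjective_of_epi p)
    rw [isZero_iff_subsingleton]
    refine subsingleton_of_forall_eq 0 fun x => injective_of_mono i (hp ?_)
    rw [map_zero, map_zero]
    exact LinearMap.congr_fun (congrArg toLinear hip) x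

/-- For an idempotent ρ ≠ 0 the quotient M → range ρ lies in F, so it is injective, and ρρ = ρ then
forces ρ = 1. -/
theorem IsSimpleObject.isIndecomposable [IsNoetherianRing A] (hF : IsTorsionFreeClass F)
    (h : IsSimpleObject F M) : IsIndecomposable F M := by
  obtain ⟨hM, hn, h⟩ := (isSimpleObject_iff hF).1 h
  refine isIndecomposable_of_idempotents hM hn fun ρ hρ => ?_
  rw [or_iff_not_imp_left]
  intro hρ0
  have hR : Nontrivial (LinearMap.range ρ) := by
    rwa [Submodule.nontrivial_iff_ne_bot, Ne, LinearMap.range_eq_bot]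
  have hinj := h (FGModuleCat.of A (LinearMap.range ρ)) ρ.rangeRestrict
    (hF.of_injective (X := FGModuleCat.of A (LinearMap.range ρ)) (Submodule.subtype _)
      (Submodule.subtype_injective _) hM) hR ρ.surjective_rangeRestrict
  refine LinearMap.ext fun x => hinj (Subtype.ext ?_)
  exact LinearMap.congr_fun hρ x

/-! ### Extremal lengths for a fixed top -/

section Serial

variable [IsArtinianRing A] [IsNoetherianRing A]
  (hA : Ideal.span {e : A | IsBiserialIdempotent e} = ⊤)

include hA

theorem isIndecomposable_iff_isUniserial
    (hF : ∀ ⦃X Y : FGModuleCat.{u} A⦄ (f : X →ₗ[A] Y), Function.Injective f → F Y → F X) :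
    IsIndecomposable F M ↔ F M ∧ Nontrivial M ∧ IsUniserial A M := by
  refine ⟨fun h => ?_, fun ⟨hM, hn, h⟩ => isIndecomposable_of_idempotents hM hn h.idempotent_eq⟩
  have hn := not_isZero_iff_nontrivial.1 h.2.1
  obtain ⟨e, he, x, hex, hx⟩ := exists_span_eq_top_of_idempotents hA (h.idempotent_eq hF)
  refine ⟨h.1, hn, (he.isUniserial_span hex).of_surjective (Submodule.subtype _) ?_⟩
  rw [← LinearMap.range_eq_top, Submodule.range_subtype, hx]

theorem isIndecomposable_iff_top (hF : IsTorsionFreeClass F) :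
    IsIndecomposable F M ↔ F M ∧ IsIndecomposable ⊤ M := by
  rw [isIndecomposable_iff_isUniserial hA fun _ _ f hf => hF.of_injective f hf,
    isIndecomposable_iff_isUniserial (F := ⊤) hA fun _ _ _ _ _ => trivial]
  simp

theorem IsIndecWithTop.exists_surjective {i j : ℕ} (hM : IsIndecWithTop S i M)
    (hN : IsIndecWithTop S j N) (hij : j ≤ i) : ∃ f : M →ₗ[A] N, Function.Surjective f := by
  obtain ⟨hM, ⟨φ⟩, hi⟩ := hM
  obtain ⟨hN, ⟨ψ⟩, hj⟩ := hN
  obtain ⟨-, hMn, hM⟩ := (isIndecomposable_iff_isUniserial hA fun _ _ _ _ _ => trivial).1 hM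
  obtain ⟨-, hNn, hN⟩ := (isIndecomposable_iff_isUniserial hA fun _ _ _ _ _ => trivial).1 hN
  refine hM.exists_surjective hA hN (FGModuleCat.isoToLinearEquiv (φ ≪≫ ψ.symm)) ?_
  rw [hi, hj]
  exact_mod_cast hij

theorem IsIndecWithTop.nonempty_iso {i : ℕ} (hM : IsIndecWithTop S i M)
    (hN : IsIndecWithTop S i N) : Nonempty (M ≅ N) := by
  obtain ⟨f, hf⟩ := hM.exists_surjective hA hN le_rfl
  exact ⟨isoOfLinearEquiv (LinearEquiv.ofBijective f
    ⟨injective_of_length_le hf (hM.2.2.trans hN.2.2.symm).le, hf⟩)⟩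

theorem IsIndecWithTop.of_surjective {i : ℕ} (hM : IsIndecWithTop S i M) (f : M →ₗ[A] N)
    (hf : Function.Surjective f) (hn : Nontrivial N) :
    ∃ j, IsIndecWithTop S j N := by
  obtain ⟨hM, ⟨φ⟩, hi⟩ := hM
  obtain ⟨-, hMn, hM⟩ := (isIndecomposable_iff_isUniserial hA fun _ _ _ _ _ => trivial).1 hM
  obtain ⟨j, hj⟩ := ENat.ne_top_iff_exists.1 (Module.length_ne_top (R := A) (M := N))
  obtain ⟨ψ⟩ := hM.nonempty_quotient_jacobson_equiv f hf
  exact ⟨j, (isIndecomposable_iff_isUniserial hA fun _ _ _ _ _ => trivial).2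
    ⟨trivial, hn, hM.of_surjective f hf⟩,
    ⟨isoOfLinearEquiv (X := top N) (Y := top M) ψ.symm ≪≫ φ⟩, hj.symm⟩

theorem IsIndecWithTop.prop_of_mem_lengthSet {i : ℕ} (hF : IsTorsionFreeClass F)
    (hM : IsIndecWithTop S i M) (hi : i ∈ lengthSet F S) : F M := by
  obtain ⟨N, hN, hNF⟩ := hi
  have := hF.isClosedUnderIsomorphisms
  exact F.prop_of_iso (hN.nonempty_iso hA hM).some hNF

theorem isIndecWithTop_iff_isSimpleObject (hF : IsTorsionFreeClass F) {m : ℕ}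
    (hm : IsLeast (lengthSet F S) m) :
    IsIndecWithTop S m M ↔ IsSimpleObject F M ∧ Nonempty (top M ≅ S) := by
  constructor
  · intro hM
    have hMF := hM.prop_of_mem_lengthSet hA hF hm.1
    refine ⟨(isSimpleObject_iff hF).2 ⟨hMF, not_isZero_iff_nontrivial.1 hM.1.2.1,
      fun N f hN hn hf => ?_⟩, hM.2.1⟩
    obtain ⟨j, hj⟩ := hM.of_surjective hA f hf hn
    refine injective_of_length_le hf ?_
    rw [hM.2.2, hj.2.2]
    exact_mod_cast hm.2 ⟨N, hj, hN⟩
  · rintro ⟨hM, hS⟩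
    have hMi := ((isIndecomposable_iff_top hA hF).1 (hM.isIndecomposable hF)).2
    obtain ⟨i, hi⟩ := ENat.ne_top_iff_exists.1 (Module.length_ne_top (R := A) (M := M))
    have hMS : IsIndecWithTop S i M := ⟨hMi, hS, hi.symm⟩
    obtain ⟨N, hN, hNF⟩ := hm.1
    obtain ⟨f, hf⟩ := hMS.exists_surjective hA hN (hm.2 ⟨M, hMS, hM.1⟩)
    have hinj := ((isSimpleObject_iff hF).1 hM).2.2 N f hNF
      (not_isZero_iff_nontrivial.1 hN.1.2.1) hf
    exact ⟨hMi, hS, (LinearEquiv.ofBijective f ⟨hinj, hf⟩).length_eq.trans hN.2.2⟩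

theorem IsIndecWithTop.isProjectiveObject (hF : IsTorsionFreeClass F) {n : ℕ}
    (hn : IsGreatest (lengthSet F S) n) (hM : IsIndecWithTop S n M) : IsProjectiveObject F M := by
  have hMF := hM.prop_of_mem_lengthSet hA hF hn.1
  refine ⟨hMF, fun X Y Z i p hip hc f => ?_⟩
  obtain ⟨-, hMn, hMu⟩ := (isIndecomposable_iff_isUniserial hA fun _ _ _ _ _ => trivial).1 hM.1
  obtain ⟨e, he, x, hex, hx⟩ := hMu.exists_span_eq_top hA
  have := hc.1.epi_g
  obtain ⟨y', hy'⟩ := surjective_of_epi p (toLinear f x)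
  -- Multiplying the lift by e keeps it above f(x) and makes its annihilator comparable with that of
  -- x.
  set y := e • y' with hy
  have hey : e • y = y := by rw [hy, ← mul_smul, he.idem]
  have hpy : toLinear p y = toLinear f x := by rw [hy, map_smul, hy', ← map_smul, hex]
  have hann : ∀ a : A, a • x = 0 → a • y = 0 := by
    rcases he.annihilator_le_or hex hey with h | h
    · exact h
    by_cases hy0 : y = 0
    · simp [hy0]
    let W : FGModuleCat A := FGModuleCat.of A (Submodule.span A {y})
    let w : W := ⟨y, Submodule.mem_span_singleton_self y⟩
    have hWn : Nontrivial W := ⟨⟨w, 0, fun h => hy0 (congrArg Subtype.val h)⟩⟩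
    have hWF : F W := hF.of_injective (X := W) (Submodule.subtype _)
      (Submodule.subtype_injective _) hc.2.2.1
    have hWu : IsUniserial A W := he.isUniserial_span hey
    obtain ⟨g₀, hg₀⟩ := exists_linearMap_span_of_annihilator_le h
    let g : W →ₗ[A] M := g₀
    have hgw : ∀ a : A, g (a • w) = a • x := fun a => hg₀ a _
    have hg : Function.Surjective g := surjective_of_span_eq_top (x := (1 : A) • w) (by
      rw [hgw, one_smul, hx])
    obtain ⟨ψ⟩ := hWu.nonempty_quotient_jacobson_equiv g hg
    obtain ⟨j, hj⟩ := ENat.ne_top_iff_exists.1 (Module.length_ne_top (R := A) (M := W))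
    have hWS : IsIndecWithTop S j W :=
      ⟨(isIndecomposable_iff_isUniserial hA fun _ _ _ _ _ => trivial).2 ⟨trivial, hWn, hWu⟩,
        ⟨isoOfLinearEquiv (X := top W) (Y := top M) ψ ≪≫ hM.2.1.some⟩, hj.symm⟩
    -- Ay lies in F with top S and surjects onto M, so maximality of n makes that surjection an
    -- isomorphism; hence the annihilators agree and x ↦ y is well defined.
    have hjn : j ≤ n := hn.2 ⟨W, hWS, hWF⟩
    have hinj : Function.Injective g := injective_of_length_le hg (by
      rw [hWS.2.2, hM.2.2]
      exact_mod_cast hjn)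
    intro a ha
    rw [← hgw, map_eq_zero_iff g hinj] at ha
    exact congrArg Subtype.val ha
  obtain ⟨g, hg⟩ := exists_linearMap_of_annihilator_le hx hann
  refine ⟨ofLinear g, toLinear_injective (LinearMap.ext fun z => ?_)⟩
  obtain ⟨a, rfl⟩ := Submodule.mem_span_singleton.1 (hx ▸ Submodule.mem_top : z ∈ _)
  rw [toLinear_comp_apply, map_smul, map_smul, map_smul, ← hpy, ← hg]
  rfl

theorem isIndecWithTop_iff_isProjectiveObject (hF : IsTorsionFreeClass F) {n : ℕ}
    (hn : IsGreatest (lengthSet F S) n) :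
    IsIndecWithTop S n M ↔
      (IsIndecomposable F M ∧ IsProjectiveObject F M) ∧ Nonempty (top M ≅ S) := by
  constructor
  · intro hM
    have hP := hM.isProjectiveObject hA hF hn
    exact ⟨⟨(isIndecomposable_iff_top hA hF).2 ⟨hP.1, hM.1⟩, hP⟩, hM.2.1⟩
  · rintro ⟨⟨hM, hP⟩, hS⟩
    obtain ⟨hMF, hMi⟩ := (isIndecomposable_iff_top hA hF).1 hM
    obtain ⟨i, hi⟩ := ENat.ne_top_iff_exists.1 (Module.length_ne_top (R := A) (M := M))
    have hMS : IsIndecWithTop S i M := ⟨hMi, hS, hi.symm⟩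
    obtain ⟨N, hN, hNF⟩ := hn.1
    obtain ⟨f, hf⟩ := hN.exists_surjective hA hMS (hn.2 ⟨M, hMS, hMF⟩)
    obtain ⟨h', hc⟩ := isConflation_of_surjective hF hNF hMF f hf
    -- Projectivity splits S^(n) → M; indecomposability of S^(n) then leaves only an isomorphism.
    obtain ⟨g, hg⟩ := hP.2 _ _ _ _ _ h' hc (𝟙 M)
    have hfg : ∀ x, f (toLinear g x) = x := fun x => LinearMap.congr_fun (congrArg toLinear hg) x
    have hMn := not_isZero_iff_nontrivial.1 hMi.2.1
    have hidem := hN.1.idempotent_eq (fun _ _ _ _ _ => trivial) (toLinear g ∘ₗ f)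
      (LinearMap.ext fun x => by simp [hfg])
    rcases hidem with h | h
    · obtain ⟨x, hx⟩ := exists_ne (0 : M)
      have h1 := LinearMap.congr_fun h (toLinear g x)
      rw [LinearMap.comp_apply, hfg, LinearMap.zero_apply] at h1
      exact absurd (by rw [← hfg x, h1, map_zero]) hx
    · have hinj : Function.Injective f := by
        intro a b hab
        have ha := LinearMap.congr_fun h a
        have hb := LinearMap.congr_fun h b
        rw [LinearMap.comp_apply, LinearMap.id_apply] at ha hb
        rw [← ha, ← hb, hab]
      exact ⟨hMi, hS, (LinearEquiv.ofBijective f ⟨hinj, hf⟩).length_eq.symm.trans hN.2.2⟩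

/-- Such a module is cyclic, hence a quotient of A. This uniform bound is what makes the maximum
exist. -/
theorem IsIndecWithTop.length_le {i : ℕ} (hM : IsIndecWithTop S i M) :
    (i : ℕ∞) ≤ Module.length A A := by
  obtain ⟨-, hMn, hMu⟩ := (isIndecomposable_iff_isUniserial hA fun _ _ _ _ _ => trivial).1 hM.1
  obtain ⟨e, he, x, hex, hx⟩ := hMu.exists_span_eq_top hA
  rw [← hM.2.2]
  exact Module.length_le_of_surjective (LinearMap.toSpanSingleton A M x)
    (surjective_of_span_eq_top (x := (1 : A)) (by simpa using hx))

theorem exists_isLeast_isGreatest_lengthSet (hF : IsTorsionFreeClass F)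
    (hM : IsIndecomposable F M) (hS : Nonempty (top M ≅ S)) :
    ∃ m n, IsLeast (lengthSet F S) m ∧ IsGreatest (lengthSet F S) n := by
  obtain ⟨hMF, hMi⟩ := (isIndecomposable_iff_top hA hF).1 hM
  obtain ⟨i, hi⟩ := ENat.ne_top_iff_exists.1 (Module.length_ne_top (R := A) (M := M))
  have hne : (lengthSet F S).Nonempty := ⟨i, M, ⟨hMi, hS, hi.symm⟩, hMF⟩
  obtain ⟨l, hl⟩ := ENat.ne_top_iff_exists.1 (Module.length_ne_top (R := A) (M := A))
  have hbdd : BddAbove (lengthSet F S) := ⟨l, fun j ⟨N, hN, _⟩ => by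
    have := hN.length_le hA
    rw [← hl] at this
    exact_mod_cast this⟩
  exact ⟨_, _, ⟨Nat.sInf_mem hne, fun j hj => Nat.sInf_le hj⟩,
    ⟨Nat.sSup_mem hne hbdd, fun j hj => le_csSup hbdd hj⟩⟩

theorem IsIndecomposable.isSimpleModule_top (hF : IsTorsionFreeClass F)
    (hM : IsIndecomposable F M) : IsSimpleModule A (top M) := by
  obtain ⟨-, hn, hu⟩ :=
    (isIndecomposable_iff_isUniserial hA fun _ _ f hf => hF.of_injective f hf).1 hM
  exact isSimpleModule_iff_isCoatom.2 hu.isCoatom_jacobson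

theorem bijOn_topClass_simpSet (hF : IsTorsionFreeClass F) :
    Set.BijOn topClass (simpSet F) (topSet F) := by
  refine ⟨?_, ?_, ?_⟩
  · rintro _ ⟨M, hM, rfl⟩
    exact ⟨M, hM.isIndecomposable hF, rfl⟩
  · rintro _ ⟨M, hM, rfl⟩ _ ⟨N, hN, rfl⟩ h
    obtain ⟨φ⟩ : Nonempty (top M ≅ top N) := Quotient.exact h
    obtain ⟨m, -, hm, -⟩ := exists_isLeast_isGreatest_lengthSet hA hF (hN.isIndecomposable hF)
      ⟨Iso.refl (top N)⟩
    exact Quotient.sound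
      (((isIndecWithTop_iff_isSimpleObject hA hF hm).2 ⟨hM, ⟨φ⟩⟩).nonempty_iso hA
        ((isIndecWithTop_iff_isSimpleObject hA hF hm).2 ⟨hN, ⟨Iso.refl _⟩⟩))
  · rintro _ ⟨M, hM, rfl⟩
    obtain ⟨m, -, hm, -⟩ := exists_isLeast_isGreatest_lengthSet hA hF hM ⟨Iso.refl (top M)⟩
    obtain ⟨N, hN, -⟩ := hm.1
    exact ⟨isoClass N, ⟨N, ((isIndecWithTop_iff_isSimpleObject hA hF hm).1 hN).1, rfl⟩,
      Quotient.sound hN.2.1⟩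

theorem bijOn_topClass_indProjSet (hF : IsTorsionFreeClass F) :
    Set.BijOn topClass (indProjSet F) (topSet F) := by
  refine ⟨?_, ?_, ?_⟩
  · rintro _ ⟨M, hM, rfl⟩
    exact ⟨M, hM.1, rfl⟩
  · rintro _ ⟨M, hM, rfl⟩ _ ⟨N, hN, rfl⟩ h
    obtain ⟨φ⟩ : Nonempty (top M ≅ top N) := Quotient.exact h
    obtain ⟨-, n, -, hn⟩ := exists_isLeast_isGreatest_lengthSet hA hF hN.1 ⟨Iso.refl (top N)⟩
    exact Quotient.sound
      (((isIndecWithTop_iff_isProjectiveObject hA hF hn).2 ⟨hM, ⟨φ⟩⟩).nonempty_iso hA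
        ((isIndecWithTop_iff_isProjectiveObject hA hF hn).2 ⟨hN, ⟨Iso.refl _⟩⟩))
  · rintro _ ⟨M, hM, rfl⟩
    obtain ⟨-, n, -, hn⟩ := exists_isLeast_isGreatest_lengthSet hA hF hM ⟨Iso.refl (top M)⟩
    obtain ⟨N, hN, -⟩ := hn.1
    exact ⟨isoClass N, ⟨N, ((isIndecWithTop_iff_isProjectiveObject hA hF hn).1 hN).1, rfl⟩,
      Quotient.sound hN.2.1⟩

end Serial

end TorsionFreeClasses

end NakayamaTorsionFree

/-! ### The main theorem -/

theorem theorem5p15 {R : Type w} {Λ : Type u} [CommRing R] [IsArtinianRing R] [Ring Λ]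
    [Algebra R Λ] [Module.Finite R Λ] (hΛ : NakayamaTorsionFree.IsNakayama Λ)
    (F : ObjectProperty (FGModuleCat.{u} Λᵐᵒᵖ))
    (hF : NakayamaTorsionFree.IsTorsionFreeClass F) :
    (∀ M, NakayamaTorsionFree.IsIndecomposable F M →
      IsSimpleModule Λᵐᵒᵖ (NakayamaTorsionFree.top M)) ∧
    Set.BijOn NakayamaTorsionFree.topClass
      (NakayamaTorsionFree.simpSet F) (NakayamaTorsionFree.topSet F) ∧
    Set.BijOn NakayamaTorsionFree.topClass
      (NakayamaTorsionFree.indProjSet F) (NakayamaTorsionFree.topSet F) ∧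
    ∀ S : FGModuleCat.{u} Λᵐᵒᵖ,
      NakayamaTorsionFree.isoClass S ∈ NakayamaTorsionFree.topSet F →
      ∃ m n : ℕ,
        IsLeast (NakayamaTorsionFree.lengthSet F S) m ∧
        IsGreatest (NakayamaTorsionFree.lengthSet F S) n ∧
        (∀ M, NakayamaTorsionFree.IsIndecWithTop S m M ↔
          NakayamaTorsionFree.IsSimpleObject F M ∧
            Nonempty (NakayamaTorsionFree.top M ≅ S)) ∧
        (∀ M, NakayamaTorsionFree.IsIndecWithTop S n M ↔
          (NakayamaTorsionFree.IsIndecomposable F M ∧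
              NakayamaTorsionFree.IsProjectiveObject F M) ∧
            Nonempty (NakayamaTorsionFree.top M ≅ S)) := by

  -- Both chain conditions descend from R, over which Λᵐᵒᵖ is a finite module.
  have : IsNoetherianRing Λᵐᵒᵖ := isNoetherian_of_tower R inferInstance
  have : IsArtinianRing Λᵐᵒᵖ := isArtinian_of_tower R inferInstance
  have hA := hΛ.span_isBiserialIdempotent
  refine ⟨fun M hM => hM.isSimpleModule_top hA hF,
    NakayamaTorsionFree.bijOn_topClass_simpSet hA hF,
    NakayamaTorsionFree.bijOn_topClass_indProjSet hA hF, ?_⟩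
  rintro S ⟨M, hM, hS⟩
  obtain ⟨m, n, hm, hn⟩ :=
    NakayamaTorsionFree.exists_isLeast_isGreatest_lengthSet hA hF hM (Quotient.exact hS.symm)
  exact ⟨m, n, hm, hn,
    fun N => NakayamaTorsionFree.isIndecWithTop_iff_isSimpleObject hA hF hm,
    fun N => NakayamaTorsionFree.isIndecWithTop_iff_isProjectiveObject hA hF hn⟩
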